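/- Let $\beta\in\mathbb{R}$. For an interval $I\subseteq\mathbb{R}$ and a continuous function $w:I\to\mathbb{R}$, let the nodal number $n(w)\in\{0,1,2,\dots\}\cup\{\infty\}$ be the supremum of all integers $k\ge 0$ for which there are points $x_0<x_1<\dots<x_k$ in $I$ with $w(x_{i-1})\,w(x_i)<0$ for $i=1,\dots,k$. Consider the problems $$(1)\qquad -u''=u^3+\beta uv^2,\quad -v''=v^3+\beta u^2v\quad\text{in }\mathbb{R},\qquad u,v\in C^2(\mathbb{R})\text{ bounded},$$ $$(2)\qquad -u''=u^3+\beta uv^2,\quad -v''=v^3+\beta u^2v\quad\text{in }[0,\infty),\qquad u,v\in C^2([0,\infty))\text{ bounded},\quad u'(0)=v'(0)=0.$$ If $\beta\neq-1$, then neither (1) nor (2) has a solution $(u,v)\not\equiv(0,0)$ with $n(u+v)<\infty$ and $n(u-v)<\infty$. If $\beta=-1$, then every solution $(u,v)$ of (1) or of (2) with $n(u+v)<\infty$ and $n(u-v)<\infty$ is a constant pair of the form $(c,c)$ or $(c,-c)$ with $c\in\mathbb{R}$. -/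

import Mathlib

open Set

/-- `w` changes sign `k` times on `S`: there are points `x₀ < x₁ < ⋯ < x_k` of `S` such that
`w (x_{i-1}) * w (x_i) < 0` for `i = 1, …, k`. -/
def HasSignChanges (S : Set ℝ) (w : ℝ → ℝ) (k : ℕ) : Prop :=
  ∃ x : Fin (k + 1) → ℝ, StrictMono x ∧ (∀ i, x i ∈ S) ∧
    ∀ i : Fin k, w (x i.castSucc) * w (x i.succ) < 0

/-- The nodal number `n(w)` of `w` on `S`: the largest `k` such that `w` changes sign `k` times
on `S`, and `⊤` if there is no largest one. -/
noncomputable def nodalNumber (S : Set ℝ) (w : ℝ → ℝ) : ℕ∞ :=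
  ⨆ (k : ℕ) (_ : HasSignChanges S w k), (k : ℕ∞)

/-- `w` is bounded and twice continuously differentiable on the interval `S`
(with one-sided derivatives at an endpoint that belongs to `S`). -/
def IsBoundedC2On (S : Set ℝ) (w : ℝ → ℝ) : Prop :=
  ContDiffOn ℝ 2 w S ∧ ∃ C : ℝ, ∀ x ∈ S, |w x| ≤ C

/-- `(u, v)` is a bounded classical solution on `S` of
`-u'' = u³ + β u v²`, `-v'' = v³ + β u² v`. -/
structure IsSolutionOn (β : ℝ) (S : Set ℝ) (u v : ℝ → ℝ) : Prop where
  regular_fst : IsBoundedC2On S u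
  regular_snd : IsBoundedC2On S v
  eq_fst : ∀ x ∈ S, -(iteratedDerivWithin 2 u S x) = u x ^ 3 + β * u x * v x ^ 2
  eq_snd : ∀ x ∈ S, -(iteratedDerivWithin 2 v S x) = v x ^ 3 + β * u x ^ 2 * v x

/-- Bounded classical solutions on the whole line. -/
def IsLineSolution (β : ℝ) (u v : ℝ → ℝ) : Prop :=
  IsSolutionOn β univ u v

/-- Bounded classical solutions on `[0, ∞)` with `u'(0) = v'(0) = 0`. Only the values of `u` and
`v` on `[0, ∞)` matter. -/
def IsHalfLineSolution (β : ℝ) (u v : ℝ → ℝ) : Prop :=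
  IsSolutionOn β (Ici 0) u v ∧
    derivWithin u (Ici 0) 0 = 0 ∧ derivWithin v (Ici 0) 0 = 0

/-! With p = u + v, q = u - v the system reads -p'' = p(ap² + bq²), -q'' = q(aq² + bp²), where a =
(1+β)/4, b = (3-β)/4 and a + b = 1. Finite nodal numbers give p and q constant signs near +∞, and
the system is invariant under p ↦ -p and q ↦ -q, so both may be taken nonnegative there.

The engine is `eq_zero_of_deriv2_le_neg_cube`. If a > 0 it applies to p + q, so both vanish on the
tail. If a ≤ 0, p and q are eventually ordered, and it applies to the smaller one. Unique
continuation carries the vanishing to the whole domain. When a ≤ 0 the surviving component solves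
f'' = -a f³; then f² is convex and bounded, so f is constant, and zero unless a = 0, that is, β =
-1. -/

/-! ### Eventual constancy of sign -/

theorem exists_tail_sign {S : Set ℝ} {w : ℝ → ℝ} (hS : Ici 0 ⊆ S) (hw : nodalNumber S w < ⊤) :
    ∃ R : ℝ, 0 ≤ R ∧ ((∀ x ∈ Ici R, 0 ≤ w x) ∨ (∀ x ∈ Ici R, 0 ≤ -w x)) := by
  by_contra! hcon
  -- Every nonzero value is followed by one of opposite sign; iterating gives arbitrarily many sign
  -- changes.
  have hnext : ∀ x : {x : ℝ // 0 ≤ x ∧ w x ≠ 0},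
      ∃ y : {x : ℝ // 0 ≤ x ∧ w x ≠ 0}, x.1 < y.1 ∧ w x.1 * w y.1 < 0 := by
    rintro ⟨x, hx, hwx⟩
    obtain ⟨⟨y, hy, hwy⟩, ⟨z, hz, hwz⟩⟩ := hcon x hx
    rw [mem_Ici] at hy hz
    rcases lt_or_gt_of_ne hwx with h | h
    · have hne : x ≠ z := by rintro rfl; linarith
      exact ⟨⟨z, hx.trans hz, (show 0 < w z by linarith).ne'⟩,
        lt_of_le_of_ne hz hne, mul_neg_of_neg_of_pos h (by linarith)⟩
    · have hne : x ≠ y := by rintro rfl; linarith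
      exact ⟨⟨y, hx.trans hy, hwy.ne⟩, lt_of_le_of_ne hy hne, mul_neg_of_pos_of_neg h hwy⟩
  choose next hlt hneg using hnext
  obtain ⟨⟨y, hy, hwy⟩, -⟩ := hcon 0 le_rfl
  let x : ℕ → {x : ℝ // 0 ≤ x ∧ w x ≠ 0} := fun n => next^[n] ⟨y, hy, hwy.ne⟩
  have hx : ∀ n, x (n + 1) = next (x n) := fun n => Function.iterate_succ_apply' _ _ _
  have hmono : StrictMono fun n => (x n).1 := strictMono_nat_of_lt_succ fun n => by
    rw [hx]; exact hlt _
  have hsc : ∀ k, HasSignChanges S w k := fun k =>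
    ⟨fun i => (x i).1, fun i j hij => hmono hij, fun i => hS (x i).2.1, fun i => by
      simpa [hx] using hneg (x i)⟩
  refine hw.ne (ENat.eq_top_iff_forall_ge.2 fun k => ?_)
  exact le_iSup₂ (f := fun (k : ℕ) (_ : HasSignChanges S w k) => (k : ℕ∞)) k (hsc k)

/-! ### Concavity, convexity and unique continuation in one variable -/

theorem monotoneOn_of_hasDerivWithinAt {S : Set ℝ} (hS : Convex ℝ S) {f f' : ℝ → ℝ}
    (hf : ∀ x ∈ S, HasDerivWithinAt f (f' x) S x) (hf' : ∀ x ∈ S, 0 ≤ f' x) :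
    MonotoneOn f S :=
  monotoneOn_of_hasDerivWithinAt_nonneg hS (fun x hx => (hf x hx).continuousWithinAt)
    (fun x hx => (hf x (interior_subset hx)).mono interior_subset)
    (fun x hx => hf' x (interior_subset hx))

theorem le_affine_of_hasDerivWithinAt_le {R k : ℝ} {f f' : ℝ → ℝ}
    (hf : ∀ x ∈ Ici R, HasDerivWithinAt f (f' x) (Ici R) x) (hf' : ∀ x ∈ Ici R, f' x ≤ k)
    {x : ℝ} (hx : R ≤ x) : f x ≤ f R + k * (x - R) := by
  have h := monotoneOn_of_hasDerivWithinAt (convex_Ici R) (f := fun x => k * x - f x)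
    (f' := fun x => k * 1 - f' x)
    (fun x hx => ((hasDerivWithinAt_id x _).const_mul k).sub (hf x hx))
    (fun x hx => by linarith [hf' x hx]) (mem_Ici.2 le_rfl) (mem_Ici.2 hx) hx
  simp only at h
  linarith

theorem exists_neg_of_hasDerivWithinAt_le_neg {R k : ℝ} (hk : k < 0) {f f' : ℝ → ℝ}
    (hf : ∀ x ∈ Ici R, HasDerivWithinAt f (f' x) (Ici R) x) (hf' : ∀ x ∈ Ici R, f' x ≤ k) :
    ∃ x ∈ Ici R, f x < 0 := by
  have hx : R ≤ R + (|f R| + 1) / -k := by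
    have : 0 ≤ (|f R| + 1) / -k := div_nonneg (by positivity) (by linarith)
    linarith
  refine ⟨_, hx, (le_affine_of_hasDerivWithinAt_le hf hf' hx).trans_lt ?_⟩
  have : k * (R + (|f R| + 1) / -k - R) = -(|f R| + 1) := by
    have := hk.ne
    field_simp
    ring
  rw [this]
  linarith [le_abs_self (f R)]

theorem hasDerivWithinAt_Ici_mono {R T : ℝ} (hRT : R ≤ T) {f f' : ℝ → ℝ}
    (hf : ∀ x ∈ Ici R, HasDerivWithinAt f (f' x) (Ici R) x) :
    ∀ x ∈ Ici T, HasDerivWithinAt f (f' x) (Ici T) x :=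
  fun x hx => (hf x (hRT.trans hx)).mono (Ici_subset_Ici.2 hRT)

theorem deriv_nonneg_of_concave_of_nonneg {R : ℝ} {f f' f'' : ℝ → ℝ}
    (hf : ∀ x ∈ Ici R, HasDerivWithinAt f (f' x) (Ici R) x)
    (hf' : ∀ x ∈ Ici R, HasDerivWithinAt f' (f'' x) (Ici R) x)
    (hconc : ∀ x ∈ Ici R, f'' x ≤ 0) (hpos : ∀ x ∈ Ici R, 0 ≤ f x) :
    ∀ x ∈ Ici R, 0 ≤ f' x := by
  intro x hx
  by_contra! h
  obtain ⟨y, hy, hfy⟩ := exists_neg_of_hasDerivWithinAt_le_neg h (hasDerivWithinAt_Ici_mono hx hf)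
    fun y hy => by
      simpa using le_affine_of_hasDerivWithinAt_le (k := 0) (hasDerivWithinAt_Ici_mono hx hf')
        (fun z hz => hconc z (mem_Ici.2 (le_trans hx hz))) hy
  exact hfy.not_ge (hpos y (mem_Ici.2 (le_trans hx hy)))

/-- A nonnegative function on a half-line with `f'' ≤ -c f³` vanishes. -/
theorem eq_zero_of_deriv2_le_neg_cube {R c : ℝ} (hc : 0 < c) {f f' f'' : ℝ → ℝ}
    (hf : ∀ x ∈ Ici R, HasDerivWithinAt f (f' x) (Ici R) x)
    (hf' : ∀ x ∈ Ici R, HasDerivWithinAt f' (f'' x) (Ici R) x)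
    (hle : ∀ x ∈ Ici R, f'' x ≤ -(c * f x ^ 3)) (hpos : ∀ x ∈ Ici R, 0 ≤ f x) :
    ∀ x ∈ Ici R, f x = 0 := by
  have hconc : ∀ x ∈ Ici R, f'' x ≤ 0 := fun x hx => by
    have := hpos x hx
    have : 0 ≤ c * f x ^ 3 := by positivity
    linarith [hle x hx]
  have hd := deriv_nonneg_of_concave_of_nonneg hf hf' hconc hpos
  have hmono := monotoneOn_of_hasDerivWithinAt (convex_Ici R) hf hd
  intro x hx
  by_contra hne
  have hfx : 0 < f x := lt_of_le_of_ne (hpos x hx) (Ne.symm hne)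
  -- As f is nondecreasing, f'' stays below this negative constant beyond x, which forces f' < 0
  -- eventually.
  have hk : -(c * f x ^ 3) < 0 := by
    have : 0 < c * f x ^ 3 := by positivity
    linarith
  obtain ⟨y, hy, hfy⟩ := exists_neg_of_hasDerivWithinAt_le_neg hk (hasDerivWithinAt_Ici_mono hx hf')
    fun y hy => by
      have hRy : y ∈ Ici R := mem_Ici.2 (le_trans hx hy)
      have h1 : f x ^ 3 ≤ f y ^ 3 := pow_le_pow_left₀ hfx.le (hmono hx hRy hy) 3
      have h2 := mul_le_mul_of_nonneg_left h1 hc.le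
      linarith [hle y hRy]
  exact hfy.not_ge (hd y (mem_Ici.2 (le_trans hx hy)))

theorem deriv_nonpos_of_convex_of_le {R C : ℝ} {f f' f'' : ℝ → ℝ}
    (hf : ∀ x ∈ Ici R, HasDerivWithinAt f (f' x) (Ici R) x)
    (hf' : ∀ x ∈ Ici R, HasDerivWithinAt f' (f'' x) (Ici R) x)
    (hconv : ∀ x ∈ Ici R, 0 ≤ f'' x) (hC : ∀ x ∈ Ici R, f x ≤ C) :
    ∀ x ∈ Ici R, f' x ≤ 0 := by
  intro x hx
  have := deriv_nonneg_of_concave_of_nonneg (f := fun x => C - f x) (f' := fun x => -f' x)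
    (f'' := fun x => -f'' x) (fun x hx => (hf x hx).const_sub C) (fun x hx => (hf' x hx).neg)
    (fun x hx => by linarith [hconv x hx]) (fun x hx => by linarith [hC x hx]) x hx
  linarith

/-- A solution of `f'' = -g f` with bounded `g` that vanishes near `+∞` vanishes. -/
theorem eq_zero_of_eq_zero_on_tail {S : Set ℝ} (hS : Convex ℝ S) {R M : ℝ} (hRS : Ici R ⊆ S)
    {f f' g : ℝ → ℝ} (hf : ∀ x ∈ S, HasDerivWithinAt f (f' x) S x)
    (hf' : ∀ x ∈ S, HasDerivWithinAt f' (-(f x * g x)) S x) (hg : ∀ x ∈ S, |g x| ≤ M)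
    (h0 : ∀ x ∈ Ici R, f x = 0) : ∀ x ∈ S, f x = 0 := by
  have hRS' : R ∈ S := hRS (mem_Ici.2 le_rfl)
  have hf'R : f' R = 0 :=
    (uniqueDiffOn_Ici R R (mem_Ici.2 le_rfl)).eq_deriv _ ((hf R hRS').mono hRS)
      ((hasDerivWithinAt_const R (Ici R) (0 : ℝ)).congr h0 (h0 R (mem_Ici.2 le_rfl)))
  -- Backward Grönwall: 2ff'(1 - g) ≥ -(1 + M)(f² + f'²), so the weighted energy increases up to its
  -- value 0 at R.
  have hmono := monotoneOn_of_hasDerivWithinAt hS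
    (f := fun x => (f x ^ 2 + f' x ^ 2) * Real.exp ((1 + M) * x))
    (f' := fun x => (2 * f x * f' x - 2 * f' x * (f x * g x)
      + (1 + M) * (f x ^ 2 + f' x ^ 2)) * Real.exp ((1 + M) * x))
    (fun x hx => by
      have h1 := ((hf x hx).pow 2).add ((hf' x hx).pow 2)
      have h2 := ((hasDerivWithinAt_id x S).const_mul (1 + M)).exp
      refine (h1.mul h2).congr_deriv ?_
      simp
      ring)
    (fun x hx => by
      refine mul_nonneg ?_ (Real.exp_pos _).le
      have h1 := abs_le.1 (hg x hx)
      nlinarith [mul_nonneg (by linarith : 0 ≤ M - g x) (sq_nonneg (f x + f' x)),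
        mul_nonneg (by linarith : 0 ≤ M + g x) (sq_nonneg (f x - f' x)),
        sq_nonneg (f x + f' x)])
  intro x hx
  rcases le_total R x with h | h
  · exact h0 x h
  · have h1 := hmono hx hRS' h
    simp only [h0 R (mem_Ici.2 le_rfl), hf'R] at h1
    have h2 : f x ^ 2 + f' x ^ 2 ≤ 0 := by
      by_contra! h2
      have := mul_pos h2 (Real.exp_pos ((1 + M) * x))
      norm_num at h1
      linarith
    have h3 : f x ^ 2 = 0 := le_antisymm (by nlinarith [sq_nonneg (f' x)]) (sq_nonneg _)
    exact pow_eq_zero_iff (two_ne_zero) |>.1 h3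

/-! ### The system for sum and difference -/

/-- The system satisfied by `p = u + v` and `q = u - v`, with first derivatives `p'`, `q'`. -/
structure IsCubicSystemOn (a b : ℝ) (S : Set ℝ) (p p' q q' : ℝ → ℝ) : Prop where
  deriv_fst : ∀ x ∈ S, HasDerivWithinAt p (p' x) S x
  deriv2_fst : ∀ x ∈ S, HasDerivWithinAt p' (-(p x * (a * p x ^ 2 + b * q x ^ 2))) S x
  deriv_snd : ∀ x ∈ S, HasDerivWithinAt q (q' x) S x
  deriv2_snd : ∀ x ∈ S, HasDerivWithinAt q' (-(q x * (a * q x ^ 2 + b * p x ^ 2))) S x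

namespace IsCubicSystemOn

variable {a b : ℝ} {S T : Set ℝ} {p p' q q' : ℝ → ℝ}

theorem mono (h : IsCubicSystemOn a b S p p' q q') (hT : T ⊆ S) :
    IsCubicSystemOn a b T p p' q q' :=
  ⟨fun x hx => (h.deriv_fst x (hT hx)).mono hT, fun x hx => (h.deriv2_fst x (hT hx)).mono hT,
    fun x hx => (h.deriv_snd x (hT hx)).mono hT, fun x hx => (h.deriv2_snd x (hT hx)).mono hT⟩

theorem symm (h : IsCubicSystemOn a b S p p' q q') : IsCubicSystemOn a b S q q' p p' :=
  ⟨h.deriv_snd, h.deriv2_snd, h.deriv_fst, h.deriv2_fst⟩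

theorem neg_fst (h : IsCubicSystemOn a b S p p' q q') :
    IsCubicSystemOn a b S (fun x => -p x) (fun x => -p' x) q q' :=
  ⟨fun x hx => (h.deriv_fst x hx).neg,
    fun x hx => (h.deriv2_fst x hx).neg.congr_deriv (by ring),
    h.deriv_snd, fun x hx => (h.deriv2_snd x hx).congr_deriv (by ring)⟩

theorem neg_snd (h : IsCubicSystemOn a b S p p' q q') :
    IsCubicSystemOn a b S p p' (fun x => -q x) (fun x => -q' x) :=
  h.symm.neg_fst.symm

/-- For s = p + q one has s'' = -s(a(p - q)² + pq), while s² = (p - q)² + 4pq; hence the constant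
min(a, 1/4). The sign of b plays no role. -/
theorem eq_zero_of_nonneg {R : ℝ} (h : IsCubicSystemOn a b (Ici R) p p' q q') (hab : a + b = 1)
    (ha : 0 < a) (hp : ∀ x ∈ Ici R, 0 ≤ p x) (hq : ∀ x ∈ Ici R, 0 ≤ q x) :
    ∀ x ∈ Ici R, p x = 0 ∧ q x = 0 := by
  have hb : b = 1 - a := by linarith
  have hs := eq_zero_of_deriv2_le_neg_cube (c := min a (1 / 4)) (by positivity)
    (fun x hx => (h.deriv_fst x hx).add (h.deriv_snd x hx))
    (fun x hx => (h.deriv2_fst x hx).add (h.deriv2_snd x hx))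
    (fun x hx => by
      have h1 := hp x hx
      have h2 := hq x hx
      have h3 : min a (1 / 4) ≤ a := min_le_left _ _
      have h4 : min a (1 / 4) ≤ 1 / 4 := min_le_right _ _
      have h5 : min a (1 / 4) * (p x + q x) ^ 2 ≤ a * (p x - q x) ^ 2 + p x * q x := by
        nlinarith [mul_nonneg (sub_nonneg.2 h3) (sq_nonneg (p x - q x)),
          mul_nonneg (sub_nonneg.2 h4) (mul_nonneg h1 h2)]
      have h6 := mul_le_mul_of_nonneg_left h5 (add_nonneg h1 h2)
      simp only [Pi.add_apply]
      rw [hb]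
      linarith)
    (fun x hx => add_nonneg (hp x hx) (hq x hx))
  intro x hx
  have h1 := hp x hx
  have h2 := hq x hx
  have h3 := hs x hx
  simp only [Pi.add_apply] at h3
  constructor <;> linarith

/-- Since b = 1 - a > 0, q ≤ p gives aq² + bp² ≥ (a + b)q² = q², so q'' ≤ -q³. -/
theorem snd_eq_zero_of_le {R : ℝ} (h : IsCubicSystemOn a b (Ici R) p p' q q') (hab : a + b = 1)
    (ha : a ≤ 0) (hq : ∀ x ∈ Ici R, 0 ≤ q x) (hqp : ∀ x ∈ Ici R, q x ≤ p x) :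
    ∀ x ∈ Ici R, q x = 0 := by
  refine eq_zero_of_deriv2_le_neg_cube one_pos h.deriv_snd h.deriv2_snd (fun x hx => ?_) hq
  have h1 : q x ^ 2 ≤ p x ^ 2 := pow_le_pow_left₀ (hq x hx) (hqp x hx) 2
  have h2 : q x ^ 2 ≤ a * q x ^ 2 + b * p x ^ 2 := by
    have : b = 1 - a := by linarith
    subst this
    nlinarith [mul_nonneg (by linarith : 0 ≤ 1 - a) (sub_nonneg.2 h1)]
  nlinarith [mul_le_mul_of_nonneg_left h2 (hq x hx)]

theorem exists_tail_eq_zero_of_nonneg {R C : ℝ} (h : IsCubicSystemOn a b (Ici R) p p' q q')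
    (hab : a + b = 1) (ha : a ≤ 0) (hp : ∀ x ∈ Ici R, 0 ≤ p x) (hq : ∀ x ∈ Ici R, 0 ≤ q x)
    (hpC : ∀ x ∈ Ici R, |p x| ≤ C) (hqC : ∀ x ∈ Ici R, |q x| ≤ C) :
    ∃ T, R ≤ T ∧ ((∀ x ∈ Ici T, p x = 0) ∨ (∀ x ∈ Ici T, q x = 0)) := by
  have hb : b = 1 - a := by linarith
  suffices hord : ∃ T, R ≤ T ∧
      ((∀ x ∈ Ici T, p x ≤ q x) ∨ (∀ x ∈ Ici T, q x ≤ p x)) by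
    obtain ⟨T, hT, hle⟩ := hord
    have hsub := Ici_subset_Ici.2 hT
    refine ⟨T, hT, hle.imp (fun hle => ?_) (fun hle => ?_)⟩
    · exact (h.mono hsub).symm.snd_eq_zero_of_le hab ha (fun x hx => hp x (hsub hx)) hle
    · exact (h.mono hsub).snd_eq_zero_of_le hab ha (fun x hx => hq x (hsub hx)) hle
  let d : ℝ → ℝ := fun x => p x - q x
  let d' : ℝ → ℝ := fun x => p' x - q' x
  have hd : ∀ x ∈ Ici R, HasDerivWithinAt d (d' x) (Ici R) x :=
    fun x hx => (h.deriv_fst x hx).sub (h.deriv_snd x hx)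
  have hd' : ∀ x ∈ Ici R, HasDerivWithinAt d'
      (d x * (-a * (p x ^ 2 + q x ^ 2) + (1 - 2 * a) * (p x * q x))) (Ici R) x :=
    fun x hx => ((h.deriv2_fst x hx).sub (h.deriv2_snd x hx)).congr_deriv (by
      simp only [d]; rw [hb]; ring)
  have hsq : ∀ x ∈ Ici R, HasDerivWithinAt (fun x => d x ^ 2) (2 * (d x * d' x)) (Ici R) x :=
    -- The factor multiplying d in d'' is nonnegative, so d² is convex whatever the sign of d; being
    -- bounded, it is nonincreasing.
    fun x hx => ((hd x hx).pow 2).congr_deriv (by simp; ring)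
  have hsq' := deriv_nonpos_of_convex_of_le (C := (2 * C) ^ 2) hsq
    (fun x hx => ((hd x hx).mul (hd' x hx)).const_mul 2)
    (fun x hx => by
      have h1 : 0 ≤ -a * (p x ^ 2 + q x ^ 2) + (1 - 2 * a) * (p x * q x) :=
        add_nonneg (mul_nonneg (by linarith) (by positivity))
          (mul_nonneg (by linarith) (mul_nonneg (hp x hx) (hq x hx)))
      nlinarith [mul_nonneg (sq_nonneg (d x)) h1, sq_nonneg (d' x)])
    (fun x hx => sq_le_sq' (by
      have := abs_le.1 (hpC x hx); have := abs_le.1 (hqC x hx); simp only [d]; linarith) (by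
      have := abs_le.1 (hpC x hx); have := abs_le.1 (hqC x hx); simp only [d]; linarith))
  -- After a zero d stays zero; without zeros d keeps its sign. Either way p and q are ordered.
  by_cases hz : ∃ T ∈ Ici R, d T = 0
  · obtain ⟨T, hT, hdT⟩ := hz
    refine ⟨T, hT, Or.inl fun x hx => ?_⟩
    have h1 := le_affine_of_hasDerivWithinAt_le (hasDerivWithinAt_Ici_mono hT hsq)
      (fun y hy => hsq' y (mem_Ici.2 (le_trans hT hy))) hx
    simp only [hdT] at h1
    have h2 : d x = 0 := pow_eq_zero_iff two_ne_zero |>.1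
      (le_antisymm (by linarith) (sq_nonneg (d x)))
    simp only [d] at h2
    linarith
  · push Not at hz
    refine ⟨R, le_rfl, ?_⟩
    have hcont : ContinuousOn d (Ici R) := fun x hx => (hd x hx).continuousWithinAt
    by_contra! hcon
    obtain ⟨⟨x, hx, hqx⟩, ⟨y, hy, hpy⟩⟩ := hcon
    obtain ⟨z, hz1, hz2⟩ := isPreconnected_Ici.intermediate_value hy hx hcont
      (show (0 : ℝ) ∈ Icc (d y) (d x) from ⟨by simp only [d]; linarith, by simp only [d]; linarith⟩)
    exact hz z hz1 hz2

theorem fst_eq_zero_of_tail (h : IsCubicSystemOn a b S p p' q q') (hS : Convex ℝ S) {R C : ℝ}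
    (hRS : Ici R ⊆ S) (hpC : ∀ x ∈ S, |p x| ≤ C) (hqC : ∀ x ∈ S, |q x| ≤ C)
    (h0 : ∀ x ∈ Ici R, p x = 0) : ∀ x ∈ S, p x = 0 := by
  refine eq_zero_of_eq_zero_on_tail hS (M := |a| * C ^ 2 + |b| * C ^ 2) hRS h.deriv_fst
    h.deriv2_fst (fun x hx => ?_) h0
  have h1 : |p x| ^ 2 ≤ C ^ 2 := pow_le_pow_left₀ (abs_nonneg _) (hpC x hx) 2
  have h2 : |q x| ^ 2 ≤ C ^ 2 := pow_le_pow_left₀ (abs_nonneg _) (hqC x hx) 2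
  refine (abs_add_le _ _).trans ?_
  rw [abs_mul, abs_mul, abs_pow, abs_pow]
  gcongr

/-- The nonnegativity assumption of the tail lemmas can be replaced by constancy of signs. -/
theorem exists_nonneg_of_signs {R : ℝ} (h : IsCubicSystemOn a b S p p' q q')
    (hp : (∀ x ∈ Ici R, 0 ≤ p x) ∨ (∀ x ∈ Ici R, 0 ≤ -p x))
    (hq : (∀ x ∈ Ici R, 0 ≤ q x) ∨ (∀ x ∈ Ici R, 0 ≤ -q x)) :
    ∃ P P' Q Q' : ℝ → ℝ, IsCubicSystemOn a b S P P' Q Q' ∧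
      (∀ x, |P x| = |p x|) ∧ (∀ x, |Q x| = |q x|) ∧
      (∀ x ∈ Ici R, 0 ≤ P x) ∧ (∀ x ∈ Ici R, 0 ≤ Q x) := by
  rcases hp with hp | hp <;> rcases hq with hq | hq
  · exact ⟨_, _, _, _, h, fun _ => rfl, fun _ => rfl, hp, hq⟩
  · exact ⟨_, _, _, _, h.neg_snd, fun _ => rfl, fun _ => abs_neg _, hp, hq⟩
  · exact ⟨_, _, _, _, h.neg_fst, fun _ => abs_neg _, fun _ => rfl, hp, hq⟩
  · exact ⟨_, _, _, _, h.neg_fst.neg_snd, fun _ => abs_neg _, fun _ => abs_neg _, hp, hq⟩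

theorem eq_zero_or_eq_zero (h : IsCubicSystemOn a b S p p' q q') (hab : a + b = 1)
    (hS : Convex ℝ S) {R C : ℝ} (hRS : Ici R ⊆ S)
    (hpC : ∀ x ∈ S, |p x| ≤ C) (hqC : ∀ x ∈ S, |q x| ≤ C)
    (hp : (∀ x ∈ Ici R, 0 ≤ p x) ∨ (∀ x ∈ Ici R, 0 ≤ -p x))
    (hq : (∀ x ∈ Ici R, 0 ≤ q x) ∨ (∀ x ∈ Ici R, 0 ≤ -q x)) :
    (0 < a ∧ ∀ x ∈ S, p x = 0 ∧ q x = 0) ∨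
      (a ≤ 0 ∧ ((∀ x ∈ S, p x = 0) ∨ (∀ x ∈ S, q x = 0))) := by
  obtain ⟨P, P', Q, Q', H, hPp, hQq, hP, hQ⟩ := h.exists_nonneg_of_signs hp hq
  have hp0 : ∀ x, P x = 0 → p x = 0 := fun x hx => by simpa [hx] using (hPp x).symm
  have hq0 : ∀ x, Q x = 0 → q x = 0 := fun x hx => by simpa [hx] using (hQq x).symm
  rcases lt_or_ge 0 a with ha | ha
  · have h0 := (H.mono hRS).eq_zero_of_nonneg hab ha hP hQ
    refine Or.inl ⟨ha, fun x hx => ⟨?_, ?_⟩⟩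
    · exact h.fst_eq_zero_of_tail hS hRS hpC hqC (fun x hx => hp0 x (h0 x hx).1) x hx
    · exact h.symm.fst_eq_zero_of_tail hS hRS hqC hpC (fun x hx => hq0 x (h0 x hx).2) x hx
  · obtain ⟨T, hT, h0⟩ := (H.mono hRS).exists_tail_eq_zero_of_nonneg (C := C) hab ha hP hQ
      (fun x hx => hPp x ▸ hpC x (hRS hx)) (fun x hx => hQq x ▸ hqC x (hRS hx))
    have hTS := (Ici_subset_Ici.2 hT).trans hRS
    refine Or.inr ⟨ha, h0.imp (fun h0 => ?_) (fun h0 => ?_)⟩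
    · exact h.fst_eq_zero_of_tail hS hTS hpC hqC (fun x hx => hp0 x (h0 x hx))
    · exact h.symm.fst_eq_zero_of_tail hS hTS hqC hpC (fun x hx => hq0 x (h0 x hx))

end IsCubicSystemOn

/-! ### Liouville property for the surviving component -/

/-- `S` is the whole line, or it is `[0, ∞)` and the derivative `f'` vanishes at `0`. -/
def IsLineOrNeumann (S : Set ℝ) (f' : ℝ → ℝ) : Prop :=
  S = univ ∨ S = Ici 0 ∧ f' 0 = 0

namespace IsLineOrNeumann

variable {S : Set ℝ} {f f' f'' : ℝ → ℝ}

theorem convex (hS : IsLineOrNeumann S f') : Convex ℝ S := by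
  rcases hS with rfl | ⟨rfl, -⟩
  exacts [convex_univ, convex_Ici 0]

theorem Ici_subset (hS : IsLineOrNeumann S f') : Ici 0 ⊆ S := by
  rcases hS with rfl | ⟨rfl, -⟩
  exacts [subset_univ _, Subset.rfl]

theorem uniqueDiffOn (hS : IsLineOrNeumann S f') : UniqueDiffOn ℝ S := by
  rcases hS with rfl | ⟨rfl, -⟩
  exacts [uniqueDiffOn_univ, uniqueDiffOn_Ici 0]

/-- Boundedness above at +∞ gives f' ≤ 0. The reverse inequality comes from reflection on the line,
and from f'(0) = 0 with f' nondecreasing on the half-line. -/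
theorem deriv_eq_zero_of_convex_of_le (hS : IsLineOrNeumann S f') {C : ℝ}
    (hf : ∀ x ∈ S, HasDerivWithinAt f (f' x) S x)
    (hf' : ∀ x ∈ S, HasDerivWithinAt f' (f'' x) S x)
    (hconv : ∀ x ∈ S, 0 ≤ f'' x) (hC : ∀ x ∈ S, f x ≤ C) : ∀ x ∈ S, f' x = 0 := by
  intro x hx
  have hmono := monotoneOn_of_hasDerivWithinAt hS.convex hf' hconv
  rcases hS with rfl | ⟨rfl, h0⟩
  · refine le_antisymm ?_ ?_
    · exact deriv_nonpos_of_convex_of_le (R := x) (fun y _ => (hf y trivial).mono (subset_univ _))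
        (fun y _ => (hf' y trivial).mono (subset_univ _)) (fun y _ => hconv y trivial)
        (fun y _ => hC y trivial) x (mem_Ici.2 le_rfl)
    · have h1 := deriv_nonpos_of_convex_of_le (R := -x) (f := fun y => f (-y))
        (f' := fun y => -f' (-y)) (f'' := fun y => f'' (-y)) (C := C)
        (fun y _ => by
          have h2 := (hf (-y) trivial).hasDerivAt Filter.univ_mem
          exact (h2.comp y (hasDerivAt_neg y)).hasDerivWithinAt.congr_deriv (by simp))
        (fun y _ => by
          have h2 := (hf' (-y) trivial).hasDerivAt Filter.univ_mem
          exact (h2.comp y (hasDerivAt_neg y)).neg.hasDerivWithinAt.congr_deriv (by simp))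
        (fun y _ => hconv _ trivial) (fun y _ => hC _ trivial) (-x) (mem_Ici.2 le_rfl)
      simpa using h1
  · refine le_antisymm (deriv_nonpos_of_convex_of_le hf hf' hconv hC x hx) ?_
    exact h0 ▸ hmono (mem_Ici.2 le_rfl) hx hx

/-- A bounded solution of `f'' = k f³` with `0 ≤ k` is constant, and zero if `k ≠ 0`. -/
theorem const_of_deriv2_eq_cube (hS : IsLineOrNeumann S f') {k C : ℝ} (hk : 0 ≤ k)
    (hf : ∀ x ∈ S, HasDerivWithinAt f (f' x) S x)
    (hf' : ∀ x ∈ S, HasDerivWithinAt f' (k * f x ^ 3) S x) (hC : ∀ x ∈ S, |f x| ≤ C) :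
    ∃ c, (∀ x ∈ S, f x = c) ∧ (k ≠ 0 → c = 0) := by
  have hS2 : IsLineOrNeumann S (fun x => 2 * (f x * f' x)) :=
    hS.imp id fun ⟨h1, h2⟩ => ⟨h1, by simp [h2]⟩
  have hd2 : ∀ x ∈ S, HasDerivWithinAt (fun x => 2 * (f x * f' x))
      (2 * (f' x * f' x + f x * (k * f x ^ 3))) S x :=
    fun x hx => ((hf x hx).mul (hf' x hx)).const_mul 2
  have hd := hS2.deriv_eq_zero_of_convex_of_le (f := fun x => f x ^ 2) (C := C ^ 2)
    (fun x hx => ((hf x hx).pow 2).congr_deriv (by simp; ring)) hd2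
    (fun x _ => by
      have : f x * (k * f x ^ 3) = k * (f x ^ 2) ^ 2 := by ring
      rw [this]
      nlinarith [mul_self_nonneg (f' x), mul_nonneg hk (sq_nonneg (f x ^ 2))])
    (fun x hx => by
      rw [← sq_abs]; exact pow_le_pow_left₀ (abs_nonneg _) (hC x hx) 2)
  -- (f²)' vanishes identically, hence so does (f²)'' = 2(f'² + kf⁴), a sum of nonnegative terms.
  have hzero : ∀ x ∈ S, f' x = 0 ∧ k * (f x ^ 2) ^ 2 = 0 := fun x hx => by
    have h1 := (hS.uniqueDiffOn x hx).eq_deriv _ (hd2 x hx)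
      ((hasDerivWithinAt_const x S (0 : ℝ)).congr hd (hd x hx))
    have h2 := mul_nonneg hk (sq_nonneg (f x ^ 2))
    have h3 := mul_self_nonneg (f' x)
    have h4 : f' x * f' x + k * (f x ^ 2) ^ 2 = 0 := by linarith
    exact ⟨mul_self_eq_zero.1 (by linarith), by linarith⟩
  have h0 : (0 : ℝ) ∈ S := hS.Ici_subset (mem_Ici.2 le_rfl)
  refine ⟨f 0, fun x hx => ?_, fun hk0 => ?_⟩
  · have hm := monotoneOn_of_hasDerivWithinAt hS.convex hf fun x hx => (hzero x hx).1.ge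
    have hm' := monotoneOn_of_hasDerivWithinAt hS.convex (fun x hx => (hf x hx).neg)
      fun x hx => by simp [(hzero x hx).1]
    rcases le_total x 0 with h | h
    · have h1 := hm hx h0 h
      have h2 := hm' hx h0 h
      simp only [Pi.neg_apply] at h2
      linarith
    · have h1 := hm h0 hx h
      have h2 := hm' h0 hx h
      simp only [Pi.neg_apply] at h2
      linarith
  · simpa [hk0] using (hzero 0 h0).2

end IsLineOrNeumann

/-! ### Return to the original system -/

theorem IsBoundedC2On.hasDerivWithinAt {S : Set ℝ} (hS : UniqueDiffOn ℝ S) {w : ℝ → ℝ}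
    (hw : IsBoundedC2On S w) {x : ℝ} (hx : x ∈ S) :
    HasDerivWithinAt w (derivWithin w S x) S x ∧
      HasDerivWithinAt (derivWithin w S) (iteratedDerivWithin 2 w S x) S x := by
  refine ⟨(hw.1.differentiableOn (by norm_num) x hx).hasDerivWithinAt, ?_⟩
  have h1 : ContDiffOn ℝ 1 (derivWithin w S) S := hw.1.derivWithin hS (by norm_num)
  have h2 := (h1.differentiableOn (by norm_num) x hx).hasDerivWithinAt
  have h3 : iteratedDerivWithin 2 w S x = derivWithin (derivWithin w S) S x := by
    rw [iteratedDerivWithin_succ]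
    exact derivWithin_congr (fun y _ => by rw [iteratedDerivWithin_one]) (by
      rw [iteratedDerivWithin_one])
  rwa [h3]

theorem IsSolutionOn.isCubicSystemOn {β : ℝ} {S : Set ℝ} (hS : UniqueDiffOn ℝ S) {u v : ℝ → ℝ}
    (h : IsSolutionOn β S u v) :
    IsCubicSystemOn ((1 + β) / 4) ((3 - β) / 4) S
      (fun x => u x + v x) (fun x => derivWithin u S x + derivWithin v S x)
      (fun x => u x - v x) (fun x => derivWithin u S x - derivWithin v S x) := by
  have hu := fun x hx => h.regular_fst.hasDerivWithinAt hS (x := x) hx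
  have hv := fun x hx => h.regular_snd.hasDerivWithinAt hS (x := x) hx
  refine ⟨fun x hx => (hu x hx).1.add (hv x hx).1, fun x hx => ?_,
    fun x hx => (hu x hx).1.sub (hv x hx).1, fun x hx => ?_⟩
  · refine ((hu x hx).2.add (hv x hx).2).congr_deriv ?_
    linear_combination -(h.eq_fst x hx) - h.eq_snd x hx
  · refine ((hu x hx).2.sub (hv x hx).2).congr_deriv ?_
    linear_combination -(h.eq_fst x hx) + h.eq_snd x hx

theorem IsSolutionOn.const_of_nodalNumber_lt_top {β : ℝ} {S : Set ℝ} {u v : ℝ → ℝ}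
    (h : IsSolutionOn β S u v) (hSu : IsLineOrNeumann S (derivWithin u S))
    (hSv : IsLineOrNeumann S (derivWithin v S))
    (hp : nodalNumber S (fun x => u x + v x) < ⊤)
    (hq : nodalNumber S (fun x => u x - v x) < ⊤) :
    ∃ c : ℝ, (β ≠ -1 → c = 0) ∧
      ((∀ x ∈ S, u x = c ∧ v x = c) ∨ (∀ x ∈ S, u x = c ∧ v x = -c)) := by
  have hsys := h.isCubicSystemOn hSu.uniqueDiffOn
  obtain ⟨Cu, hCu⟩ := h.regular_fst.2
  obtain ⟨Cv, hCv⟩ := h.regular_snd.2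
  have hpC : ∀ x ∈ S, |u x + v x| ≤ Cu + Cv := fun x hx =>
    (abs_add_le _ _).trans (add_le_add (hCu x hx) (hCv x hx))
  have hqC : ∀ x ∈ S, |u x - v x| ≤ Cu + Cv := fun x hx =>
    (abs_sub _ _).trans (add_le_add (hCu x hx) (hCv x hx))
  have hSp : IsLineOrNeumann S (fun x => derivWithin u S x + derivWithin v S x) := by
    rcases hSu with h1 | ⟨h1, h2⟩
    · exact Or.inl h1
    · rcases hSv with h3 | ⟨-, h3⟩
      · exact Or.inl h3
      · exact Or.inr ⟨h1, by simp [h2, h3]⟩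
  have hSq : IsLineOrNeumann S (fun x => derivWithin u S x - derivWithin v S x) := by
    rcases hSu with h1 | ⟨h1, h2⟩
    · exact Or.inl h1
    · rcases hSv with h3 | ⟨-, h3⟩
      · exact Or.inl h3
      · exact Or.inr ⟨h1, by simp [h2, h3]⟩
  obtain ⟨R₁, hR₁, hp⟩ := exists_tail_sign hSu.Ici_subset hp
  obtain ⟨R₂, hR₂, hq⟩ := exists_tail_sign hSu.Ici_subset hq
  have hsub₁ : Ici (max R₁ R₂) ⊆ Ici R₁ := Ici_subset_Ici.2 (le_max_left _ _)
  have hsub₂ : Ici (max R₁ R₂) ⊆ Ici R₂ := Ici_subset_Ici.2 (le_max_right _ _)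
  rcases hsys.eq_zero_or_eq_zero (by ring) hSu.convex
      (hsub₁.trans ((Ici_subset_Ici.2 hR₁).trans hSu.Ici_subset)) hpC hqC
      (hp.imp (fun h x hx => h x (hsub₁ hx)) (fun h x hx => h x (hsub₁ hx)))
      (hq.imp (fun h x hx => h x (hsub₂ hx)) (fun h x hx => h x (hsub₂ hx)))
    with ⟨-, h0⟩ | ⟨ha, h0 | h0⟩
  · refine ⟨0, fun _ => rfl, Or.inl fun x hx => ?_⟩
    obtain ⟨h1, h2⟩ := h0 x hx
    constructor <;> linarith
  · obtain ⟨c, hc, hc0⟩ := hSq.const_of_deriv2_eq_cube (k := -((1 + β) / 4)) (by linarith)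
      hsys.deriv_snd (fun x hx => (hsys.deriv2_snd x hx).congr_deriv (by
        rw [h0 x hx]; ring)) hqC
    refine ⟨c / 2, fun hβ => ?_, Or.inr fun x hx => ?_⟩
    · rw [hc0 fun h => hβ (by linarith), zero_div]
    · have h1 := h0 x hx
      have h2 := hc x hx
      constructor <;> linarith
  · obtain ⟨c, hc, hc0⟩ := hSp.const_of_deriv2_eq_cube (k := -((1 + β) / 4)) (by linarith)
      hsys.deriv_fst (fun x hx => (hsys.deriv2_fst x hx).congr_deriv (by
        rw [h0 x hx]; ring)) hpC
    refine ⟨c / 2, fun hβ => ?_, Or.inl fun x hx => ?_⟩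
    · rw [hc0 fun h => hβ (by linarith), zero_div]
    · have h1 := h0 x hx
      have h2 := hc x hx
      constructor <;> linarith

theorem theoremt (β : ℝ) :
    (β ≠ -1 →
      (∀ u v : ℝ → ℝ, IsLineSolution β u v →
        nodalNumber univ (fun x => u x + v x) < ⊤ →
        nodalNumber univ (fun x => u x - v x) < ⊤ →
        ∀ x : ℝ, u x = 0 ∧ v x = 0) ∧
      (∀ u v : ℝ → ℝ, IsHalfLineSolution β u v →
        nodalNumber (Ici 0) (fun x => u x + v x) < ⊤ →
        nodalNumber (Ici 0) (fun x => u x - v x) < ⊤ →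
        ∀ x ∈ Ici (0 : ℝ), u x = 0 ∧ v x = 0)) ∧
    (β = -1 →
      (∀ u v : ℝ → ℝ, IsLineSolution β u v →
        nodalNumber univ (fun x => u x + v x) < ⊤ →
        nodalNumber univ (fun x => u x - v x) < ⊤ →
        ∃ c : ℝ, (∀ x : ℝ, u x = c ∧ v x = c) ∨ (∀ x : ℝ, u x = c ∧ v x = -c)) ∧
      (∀ u v : ℝ → ℝ, IsHalfLineSolution β u v →
        nodalNumber (Ici 0) (fun x => u x + v x) < ⊤ →
        nodalNumber (Ici 0) (fun x => u x - v x) < ⊤ →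
        ∃ c : ℝ, (∀ x ∈ Ici (0 : ℝ), u x = c ∧ v x = c) ∨
          (∀ x ∈ Ici (0 : ℝ), u x = c ∧ v x = -c))) := by
  have hline : ∀ u v : ℝ → ℝ, IsLineSolution β u v →
      nodalNumber univ (fun x => u x + v x) < ⊤ → nodalNumber univ (fun x => u x - v x) < ⊤ →
      ∃ c : ℝ, (β ≠ -1 → c = 0) ∧
        ((∀ x ∈ univ, u x = c ∧ v x = c) ∨ (∀ x ∈ univ, u x = c ∧ v x = -c)) :=
    fun u v h => h.const_of_nodalNumber_lt_top (Or.inl rfl) (Or.inl rfl)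
  have hhalf : ∀ u v : ℝ → ℝ, IsHalfLineSolution β u v →
      nodalNumber (Ici 0) (fun x => u x + v x) < ⊤ →
      nodalNumber (Ici 0) (fun x => u x - v x) < ⊤ →
      ∃ c : ℝ, (β ≠ -1 → c = 0) ∧ ((∀ x ∈ Ici (0 : ℝ), u x = c ∧ v x = c) ∨
        (∀ x ∈ Ici (0 : ℝ), u x = c ∧ v x = -c)) :=
    fun u v h => h.1.const_of_nodalNumber_lt_top (Or.inr ⟨rfl, h.2.1⟩) (Or.inr ⟨rfl, h.2.2⟩)
  refine ⟨fun hβ => ⟨fun u v h hp hq x => ?_, fun u v h hp hq x hx => ?_⟩,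
    fun _ => ⟨fun u v h hp hq => ?_, fun u v h hp hq => ?_⟩⟩
  · obtain ⟨c, hc, h0 | h0⟩ := hline u v h hp hq <;> simpa [hc hβ] using h0 x trivial
  · obtain ⟨c, hc, h0 | h0⟩ := hhalf u v h hp hq <;> simpa [hc hβ] using h0 x hx
  · obtain ⟨c, -, h0⟩ := hline u v h hp hq
    exact ⟨c, by simpa using h0⟩
  · obtain ⟨c, -, h0⟩ := hhalf u v h hp hq
    exact ⟨c, h0⟩
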